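/- Let $(M,g)$ be a smooth $m$-dimensional Riemannian manifold with Levi-Civita connection $\nabla$, let $f:M\to\mathbb{R}$ be a smooth function, let $\xi:=\operatorname{grad}(f)$ be its gradient, and let $\eta$ be the $1$-form $g$-dual to $\xi$, $\eta(X):=g(X,\xi)$. Write $\operatorname{Hess}(f):=\nabla(df)$, that is, $\operatorname{Hess}(f)(X,Y)=X(df(Y))-df(\nabla_XY)$; $R(X,Y)Z:=\nabla_X\nabla_YZ-\nabla_Y\nabla_XZ-\nabla_{[X,Y]}Z$ for the Riemann curvature; and $S(X,Y):=\operatorname{trace}(Z\mapsto R(Z,X)Y)=\sum_{i=1}^m g(R(E_i,X)Y,E_i)$ for the Ricci curvature, where $\{E_i\}$ is a local orthonormal frame. Suppose that $\nabla\xi=I-\eta\otimes\xi$, that is, $\nabla_X\xi=X-\eta(X)\xi$ for every vector field $X$. Then: \begin{enumerate} \item $\operatorname{Hess}(f)=g-\eta\otimes\eta$, that is, $\operatorname{Hess}(f)(X,Y)=g(X,Y)-\eta(X)\eta(Y)$ for all smooth vector fields $X,Y$ on $M$; \item $R(X,Y)\xi=\eta(X)Y-\eta(Y)X$ for all smooth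 vector fields $X,Y$ on $M$; \item $S(\xi,\xi)=(1-m)|\xi|^2$. \end{enumerate} -/

import Mathlib

open Bundle FiberBundle VectorField
open scoped Manifold ContDiff

noncomputable section

namespace RiemGeom

/-- A smooth (global) vector field. -/
def IsSmoothField {E : Type*} [NormedAddCommGroup E] [NormedSpace ℝ E]
    {H : Type*} [TopologicalSpace H] {I : ModelWithCorners ℝ E H}
    {M : Type*} [TopologicalSpace M] [ChartedSpace H M] [IsManifold I ∞ M]
    (X : Π x : M, TangentSpace I x) : Prop :=
  ContMDiff I I.tangent ∞ (fun x ↦ (⟨x, X x⟩ : TangentBundle I M))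

section Metric

variable {E : Type*} [NormedAddCommGroup E] [NormedSpace ℝ E]
  {H : Type*} [TopologicalSpace H] {I : ModelWithCorners ℝ E H}
  {M : Type*} [TopologicalSpace M] [ChartedSpace H M]
  [RiemannianBundle (fun x : M ↦ TangentSpace I x)]

/-- The right-hand side of Koszul's formula for `2 g(∇_X Y, Z)`, at the point `x`. -/
def koszul (X Y Z : Π x : M, TangentSpace I x) (x : M) : ℝ :=
  d% (fun y ↦ inner ℝ (Y y) (Z y)) x (X x)
    + d% (fun y ↦ inner ℝ (Z y) (X y)) x (Y x)
    - d% (fun y ↦ inner ℝ (X y) (Y y)) x (Z x)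
    - inner ℝ (X x) (mlieBracket I Y Z x)
    + inner ℝ (Y x) (mlieBracket I Z X x)
    + inner ℝ (Z x) (mlieBracket I X Y x)

/-- The one-form dual to a vector field with respect to the metric, `v ↦ g(X, v)`. -/
def flat (X : Π x : M, TangentSpace I x) (x : M) : TangentSpace I x →L[ℝ] ℝ :=
  innerSL ℝ (X x)

theorem mdiffAt_inner [IsManifold I ∞ M]
    [IsContMDiffRiemannianBundle I ∞ E (fun x : M ↦ TangentSpace I x)]
    {x : M} {X Y : Π x : M, TangentSpace I x}
    (hX : MDiffAt (T% X) x) (hY : MDiffAt (T% Y) x) :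
    MDiffAt (fun y ↦ inner ℝ (X y) (Y y)) x :=
  MDifferentiableAt.inner_bundle (F := E) (E := fun x : M ↦ TangentSpace I x) hX hY

theorem clm_ext_of_fields [IsManifold I ∞ M] {x : M} {A B : TangentSpace I x →L[ℝ] TangentSpace I x}
    (h : ∀ X Z : Π x : M, TangentSpace I x, MDiffAt (T% X) x → MDiffAt (T% Z) x →
      2 * inner ℝ (A (X x)) (Z x) = 2 * inner ℝ (B (X x)) (Z x)) : A = B := by
  ext1 v
  refine ext_inner_right ℝ fun w ↦ ?_
  have := h (extend E v) (extend E w) (mdifferentiableAt_extend ..) (mdifferentiableAt_extend ..)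
  simp only [extend_apply_self] at this
  linarith

variable [FiniteDimensional ℝ E]

instance finiteDimensional_tangentSpace (x : M) : FiniteDimensional ℝ (TangentSpace I x) :=
  inferInstanceAs (FiniteDimensional ℝ E)

instance completeSpace_tangentSpace (x : M) : CompleteSpace (TangentSpace I x) :=
  FiniteDimensional.complete ℝ (TangentSpace I x)

/-- The vector that represents a covector with respect to the metric. -/
def sharp (x : M) : (TangentSpace I x →L[ℝ] ℝ) →L[ℝ] TangentSpace I x :=
  LinearMap.toContinuousLinearMap
    { toFun := fun α ↦ (InnerProductSpace.toDual ℝ (TangentSpace I x)).symm α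
      map_add' := fun α β ↦ map_add _ α β
      map_smul' := fun c α ↦ by simp }

theorem inner_sharp (x : M) (α : TangentSpace I x →L[ℝ] ℝ) (v : TangentSpace I x) :
    inner ℝ (sharp x α) v = α v :=
  InnerProductSpace.toDual_symm_apply

/-- The gradient of a function: `g(grad f, v) = df(v)`. -/
def grad (f : M → ℝ) (x : M) : TangentSpace I x := sharp x (d% f x)

end Metric

section LeviCivita

variable {E : Type*} [NormedAddCommGroup E] [NormedSpace ℝ E] [FiniteDimensional ℝ E]
  {H : Type*} [TopologicalSpace H] {I : ModelWithCorners ℝ E H}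
  {M : Type*} [TopologicalSpace M] [ChartedSpace H M] [IsManifold I ∞ M]
  [RiemannianBundle (fun x : M ↦ TangentSpace I x)]
  [IsContMDiffRiemannianBundle I ∞ E (fun x : M ↦ TangentSpace I x)]

theorem koszul_tensorial_left {x : M} {Y Z : Π x : M, TangentSpace I x}
    (hY : MDiffAt (T% Y) x) (hZ : MDiffAt (T% Z) x) :
    TensorialAt I E (fun X : Π x : M, TangentSpace I x ↦ koszul X Y Z x) x where
  smul {f X} hf hX := by
    have := FiniteDimensional.complete ℝ E
    simp [koszul, mlieBracket_smul_left hf hX, mlieBracket_smul_right hf hX,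
      mvfderiv_fun_mul hf (mdiffAt_inner hX hY), mvfderiv_fun_mul hf (mdiffAt_inner hZ hX),
      inner_add_right, inner_smul_left, inner_smul_right]
    rw [real_inner_comm (X x) (Y x)]
    ring
  add {X X'} hX hX' := by
    have := FiniteDimensional.complete ℝ E
    simp [koszul, mlieBracket_add_left hX hX', mlieBracket_add_right hX hX',
      mvfderiv_fun_add (mdiffAt_inner hX hY) (mdiffAt_inner hX' hY),
      mvfderiv_fun_add (mdiffAt_inner hZ hX) (mdiffAt_inner hZ hX'),
      inner_add_right, inner_add_left]
    ring

theorem koszul_tensorial_right {x : M} {X Y : Π x : M, TangentSpace I x}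
    (hX : MDiffAt (T% X) x) (hY : MDiffAt (T% Y) x) :
    TensorialAt I E (fun Z : Π x : M, TangentSpace I x ↦ koszul X Y Z x) x where
  smul {f Z} hf hZ := by
    have := FiniteDimensional.complete ℝ E
    simp [koszul, mlieBracket_smul_left hf hZ, mlieBracket_smul_right hf hZ,
      mvfderiv_fun_mul hf (mdiffAt_inner hY hZ), mvfderiv_fun_mul hf (mdiffAt_inner hZ hX),
      inner_add_right, inner_smul_left, inner_smul_right]
    rw [real_inner_comm (X x) (Z x)]
    ring
  add {Z Z'} hZ hZ' := by
    have := FiniteDimensional.complete ℝ E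
    simp [koszul, mlieBracket_add_left hZ hZ', mlieBracket_add_right hZ hZ',
      mvfderiv_fun_add (mdiffAt_inner hY hZ) (mdiffAt_inner hY hZ'),
      mvfderiv_fun_add (mdiffAt_inner hZ hX) (mdiffAt_inner hZ' hX),
      inner_add_right, inner_add_left]
    ring

open scoped Classical in
/-- `∇ Y` at `x` as the map `v ↦ ∇_v Y`, for the Levi-Civita connection `∇`: the vector `∇_v Y`
represents `w ↦ (1/2) koszul(v, Y, w)`. A field that is not differentiable at `x` gets the
value `0` there. -/
def leviCivitaFun (Y : Π x : M, TangentSpace I x) (x : M) :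
    TangentSpace I x →L[ℝ] TangentSpace I x :=
  if hY : MDiffAt (T% Y) x then
    sharp x ∘L
      ((1 / 2 : ℝ) • TensorialAt.mkHom₂ (fun X Z : Π x : M, TangentSpace I x ↦ koszul X Y Z x) x
        (fun _ hZ ↦ koszul_tensorial_left hY hZ) (fun _ hX ↦ koszul_tensorial_right hX hY))
  else 0

theorem inner_leviCivitaFun {x : M} {X Y Z : Π x : M, TangentSpace I x}
    (hX : MDiffAt (T% X) x) (hY : MDiffAt (T% Y) x) (hZ : MDiffAt (T% Z) x) :
    2 * inner ℝ (leviCivitaFun Y x (X x)) (Z x) = koszul X Y Z x := by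
  have h := TensorialAt.mkHom₂_apply
    (Φ := fun X Z : Π x : M, TangentSpace I x ↦ koszul X Y Z x)
    (fun _ hZ ↦ koszul_tensorial_left hY hZ) (fun _ hX ↦ koszul_tensorial_right hX hY) hX hZ
  rw [leviCivitaFun, dif_pos hY, ← h]
  simp [inner_sharp, inner_smul_left]

/-- The Levi-Civita connection of the metric, given by Koszul's formula
`2 g(∇_X Y, Z) = koszul(X, Y, Z)`. As for every `CovariantDerivative`, `leviCivita Y x (X x)`
is `∇_X Y` at `x`. -/
def leviCivita : CovariantDerivative I E (fun x : M ↦ TangentSpace I x) where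
  toFun := leviCivitaFun
  isCovariantDerivativeOnUniv :=
    { add := by
        intro Y Y' x hY hY' _
        have := FiniteDimensional.complete ℝ E
        refine clm_ext_of_fields fun X Z hX hZ ↦ ?_
        rw [inner_leviCivitaFun hX (mdifferentiableAt_add_section hY hY') hZ]
        simp only [add_apply, inner_add_left, mul_add]
        rw [inner_leviCivitaFun hX hY hZ, inner_leviCivitaFun hX hY' hZ]
        simp [koszul, mlieBracket_add_left hY hY', mlieBracket_add_right hY hY',
          mvfderiv_fun_add (mdiffAt_inner hY hZ) (mdiffAt_inner hY' hZ),
          mvfderiv_fun_add (mdiffAt_inner hX hY) (mdiffAt_inner hX hY'),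
          inner_add_right, inner_add_left]
        ring
      leibniz := by
        intro Y f x hY hf _
        have := FiniteDimensional.complete ℝ E
        refine clm_ext_of_fields fun X Z hX hZ ↦ ?_
        rw [inner_leviCivitaFun hX (hf.smul_section hY) hZ]
        have h := inner_leviCivitaFun hX hY hZ
        simp only [add_apply, smul_apply,
          ContinuousLinearMap.smulRight_apply, inner_add_left, inner_smul_left, mul_add]
        simp only [RCLike.conj_to_real, mul_left_comm (2 : ℝ) (f x)]
        rw [h]
        simp [koszul, mlieBracket_smul_left hf hY, mlieBracket_smul_right hf hY,
          mvfderiv_fun_mul hf (mdiffAt_inner hY hZ), mvfderiv_fun_mul hf (mdiffAt_inner hX hY),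
          inner_add_right, inner_smul_left, inner_smul_right]
        rw [real_inner_comm (Y x) (Z x)]
        ring }

theorem leviCivita_torsion :
    (leviCivita : CovariantDerivative I E (fun x : M ↦ TangentSpace I x)).torsion = 0 := by
  have := FiniteDimensional.complete ℝ E
  rw [CovariantDerivative.torsion_eq_zero_iff]
  intro X Y x hX hY
  refine ext_inner_right ℝ fun w ↦ ?_
  have hW : MDiffAt (T% (extend E w)) x := mdifferentiableAt_extend (I := I) (F := E) w
  have h1 := inner_leviCivitaFun hX hY hW
  have h2 := inner_leviCivitaFun hY hX hW
  have e1 := mlieBracket_swap_apply (I := I) (V := Y) (W := X) (x := x)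
  have e2 := mlieBracket_swap_apply (I := I) (V := extend E w) (W := X) (x := x)
  have e3 := mlieBracket_swap_apply (I := I) (V := extend E w) (W := Y) (x := x)
  simp only [koszul, extend_apply_self, e1, e2, e3, inner_neg_right,
    fun y ↦ real_inner_comm (X y) (Y y), fun y ↦ real_inner_comm (X y) (extend E w y),
    fun y ↦ real_inner_comm (Y y) (extend E w y)] at h1 h2
  rw [inner_sub_left, real_inner_comm w (mlieBracket I X Y x)]
  change inner ℝ (leviCivitaFun Y x (X x)) w - inner ℝ (leviCivitaFun X x (Y x)) w = _
  linarith

theorem leviCivita_metric {x : M} {X Y Z : Π x : M, TangentSpace I x}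
    (hX : MDiffAt (T% X) x) (hY : MDiffAt (T% Y) x) (hZ : MDiffAt (T% Z) x) :
    d% (fun y ↦ inner ℝ (Y y) (Z y)) x (X x) =
      inner ℝ (leviCivita Y x (X x)) (Z x) + inner ℝ (Y x) (leviCivita Z x (X x)) := by
  have h1 := inner_leviCivitaFun hX hY hZ
  have h2 := inner_leviCivitaFun hX hZ hY
  have e1 := mlieBracket_swap_apply (I := I) (V := Y) (W := X) (x := x)
  have e2 := mlieBracket_swap_apply (I := I) (V := Z) (W := X) (x := x)
  have e3 := mlieBracket_swap_apply (I := I) (V := Z) (W := Y) (x := x)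
  simp only [koszul, e1, e2, e3, inner_neg_right,
    fun y ↦ real_inner_comm (X y) (Y y), fun y ↦ real_inner_comm (X y) (Z y),
    fun y ↦ real_inner_comm (Y y) (Z y)] at h1 h2 ⊢
  rw [real_inner_comm _ (Y x)]
  change _ = inner ℝ (leviCivitaFun Y x (X x)) (Z x) + inner ℝ (leviCivitaFun Z x (X x)) (Y x)
  linarith

/-- The Hessian `∇(df)` of `f`: `(∇_X df)(Y) = X(df(Y)) - df(∇_X Y)`. -/
def hess (f : M → ℝ) (X Y : Π x : M, TangentSpace I x) (x : M) : ℝ :=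
  d% (fun y ↦ d% f y (Y y)) x (X x) - d% f x (leviCivita Y x (X x))

/-- The Riemann curvature `R(X, Y)Z = ∇_X ∇_Y Z - ∇_Y ∇_X Z - ∇_{[X, Y]} Z`. -/
def curvature (X Y Z : Π x : M, TangentSpace I x) (x : M) : TangentSpace I x :=
  leviCivita (fun y ↦ leviCivita Z y (Y y)) x (X x)
    - leviCivita (fun y ↦ leviCivita Z y (X y)) x (Y x)
    - leviCivita Z x (mlieBracket I X Y x)

/-- The Ricci curvature `S(X, Y) = ∑ i, g(R(E i, X)Y, E i)`, the trace of `Z ↦ R(Z, X)Y`, where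
`E i` are fields, smooth near `x`, that form an orthonormal basis of the tangent space at `x`. -/
def ricci (X Y : Π x : M, TangentSpace I x) (x : M) : ℝ :=
  ∑ i, inner ℝ (curvature (extend E (stdOrthonormalBasis ℝ (TangentSpace I x) i)) X Y x)
    (stdOrthonormalBasis ℝ (TangentSpace I x) i)

end LeviCivita

end RiemGeom

end

/-!
The metric is an invertible bundle map from the tangent to the cotangent bundle, so the gradient of
a `C^2` function is a differentiable field, and the torsion-free metric connection may be applied
to it. Expanding `R(X, Y)ξ` for a torse-forming field `ξ`, with `∇_v ξ = φ v + θ(v) ξ`, by the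
Leibniz rule leaves a multiple of `ξ` whose coefficient is `dθ(X, Y)`. When `φ` is constant and `θ`
is a constant multiple of the dual one-form `η` of `ξ`, the map `∇ξ` is self-adjoint, hence `η` is
closed and that term drops out. The Ricci curvature is then the trace of a multiple of the identity
plus a rank-one map.
-/

noncomputable section

namespace RiemGeom

theorem IsSmoothField.mdiffAt {E : Type*} [NormedAddCommGroup E] [NormedSpace ℝ E]
    {H : Type*} [TopologicalSpace H] {I : ModelWithCorners ℝ E H}
    {M : Type*} [TopologicalSpace M] [ChartedSpace H M] [IsManifold I ∞ M]
    {X : Π x : M, TangentSpace I x} (hX : IsSmoothField X) (x : M) : MDiffAt (T% X) x :=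
  (hX x).mdifferentiableAt (by simp)

section InvertibleHom

variable {𝕜 : Type*} [NontriviallyNormedField 𝕜]
  {EB : Type*} [NormedAddCommGroup EB] [NormedSpace 𝕜 EB]
  {HB : Type*} [TopologicalSpace HB] {IB : ModelWithCorners 𝕜 EB HB}
  {B : Type*} [TopologicalSpace B] [ChartedSpace HB B]
  {F₁ : Type*} [NormedAddCommGroup F₁] [NormedSpace 𝕜 F₁] [CompleteSpace F₁]
  {F₂ : Type*} [NormedAddCommGroup F₂] [NormedSpace 𝕜 F₂]
  {n : ℕ∞ω} {x : B}

theorem contMDiffAt_of_clm_apply {A : B → F₁ →L[𝕜] F₂} {c : B → F₁}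
    (hA : ContMDiffAt IB 𝓘(𝕜, F₁ →L[𝕜] F₂) n A x) (hAx : (A x).IsInvertible)
    (hAc : ContMDiffAt IB 𝓘(𝕜, F₂) n (fun y ↦ A y (c y)) x) :
    ContMDiffAt IB 𝓘(𝕜, F₁) n c x := by
  have hinv : ∀ᶠ y in nhds x, (A y).IsInvertible :=
    hA.continuousAt.eventually (ContinuousLinearEquiv.isOpen.mem_nhds hAx)
  have hsol : ContMDiffAt IB 𝓘(𝕜, F₁) n (fun y ↦ (A y).inverse (A y (c y))) x :=
    (hAx.contDiffAt_map_inverse.contMDiffAt.comp x hA).clm_apply hAc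
  refine hsol.congr_of_eventuallyEq ?_
  filter_upwards [hinv] with y hy
  exact (hy.inverse_apply_eq.2 rfl).symm

variable {E₁ : B → Type*} [∀ y, AddCommGroup (E₁ y)] [∀ y, Module 𝕜 (E₁ y)]
  [∀ y, TopologicalSpace (E₁ y)] [TopologicalSpace (TotalSpace F₁ E₁)]
  [FiberBundle F₁ E₁] [VectorBundle 𝕜 F₁ E₁]
  {E₂ : B → Type*} [∀ y, AddCommGroup (E₂ y)] [∀ y, Module 𝕜 (E₂ y)]
  [∀ y, TopologicalSpace (E₂ y)] [TopologicalSpace (TotalSpace F₂ E₂)]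
  [FiberBundle F₂ E₂] [VectorBundle 𝕜 F₂ E₂]
  [∀ y, IsTopologicalAddGroup (E₂ y)] [∀ y, ContinuousSMul 𝕜 (E₂ y)]

theorem contMDiffAt_of_clm_bundle_apply {Φ : Π y : B, E₁ y →L[𝕜] E₂ y} {v : Π y : B, E₁ y}
    (hΦ : ContMDiffAt IB (IB.prod 𝓘(𝕜, F₁ →L[𝕜] F₂)) n
      (fun y ↦ TotalSpace.mk' (F₁ →L[𝕜] F₂) y (Φ y)) x)
    (hΦx : (Φ x).IsInvertible)
    (hΦv : ContMDiffAt IB (IB.prod 𝓘(𝕜, F₂)) n (fun y ↦ TotalSpace.mk' F₂ y (Φ y (v y))) x) :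
    ContMDiffAt IB (IB.prod 𝓘(𝕜, F₁)) n (fun y ↦ TotalSpace.mk' F₁ y (v y)) x := by
  have h₁ := mem_baseSet_trivializationAt F₁ E₁ x
  have h₂ := mem_baseSet_trivializationAt F₂ E₂ x
  refine (contMDiffAt_section x).2
    (contMDiffAt_of_clm_apply ((contMDiffAt_hom_bundle _).1 hΦ).2 ?_ ?_)
  · rw [ContinuousLinearMap.inCoordinates_eq h₁ h₂]
    simpa using hΦx
  · refine ((contMDiffAt_section x).1 hΦv).congr_of_eventuallyEq ?_
    filter_upwards [(trivializationAt F₁ E₁ x).open_baseSet.mem_nhds h₁,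
      (trivializationAt F₂ E₂ x).open_baseSet.mem_nhds h₂] with y hy₁ hy₂
    rw [ContinuousLinearMap.inCoordinates_eq hy₁ hy₂]
    simp [hy₁]

end InvertibleHom

section MusicalIsomorphism

variable {E : Type*} [NormedAddCommGroup E] [NormedSpace ℝ E]
  {H : Type*} [TopologicalSpace H] {I : ModelWithCorners ℝ E H}
  {M : Type*} [TopologicalSpace M] [ChartedSpace H M]
  {m n : ℕ∞ω} {x : M}

theorem contMDiffAt_mvfderiv [IsManifold I 1 M] {f : M → ℝ} (hf : ContMDiffAt I 𝓘(ℝ) n f x)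
    (hmn : m + 1 ≤ n) :
    ContMDiffAt I (I.prod 𝓘(ℝ, E →L[ℝ] ℝ)) m
      (fun y ↦ TotalSpace.mk' (E →L[ℝ] ℝ) (E := fun y ↦ TangentSpace I y →L[ℝ] ℝ) y (d% f y))
      x := by
  refine (contMDiffAt_hom_bundle _).2 ⟨contMDiffAt_id, ?_⟩
  convert hf.mfderiv_const hmn using 1
  ext y v
  simp only [ContinuousLinearMap.inCoordinates, mvfderiv, Trivial.fiberBundle_trivializationAt',
    Trivial.continuousLinearMapAt_trivialization, ContinuousLinearMap.id_comp,
    ContinuousLinearMap.comp_apply, ContinuousLinearEquiv.coe_coe, inTangentCoordinates,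
    TangentBundle.continuousLinearMapAt_model_space, id_eq]
  rfl

variable [RiemannianBundle (fun x : M ↦ TangentSpace I x)] [FiniteDimensional ℝ E]

theorem contMDiffAt_sharp [IsManifold I 1 M]
    [IsContMDiffRiemannianBundle I n E (fun x : M ↦ TangentSpace I x)]
    {α : Π y : M, TangentSpace I y →L[ℝ] ℝ}
    (hα : ContMDiffAt I (I.prod 𝓘(ℝ, E →L[ℝ] ℝ)) n
      (fun y ↦ TotalSpace.mk' (E →L[ℝ] ℝ) (E := fun y ↦ TangentSpace I y →L[ℝ] ℝ) y (α y)) x) :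
    ContMDiffAt I I.tangent n (T% (fun y : M ↦ sharp y (α y))) x := by
  have := FiniteDimensional.complete ℝ E
  obtain ⟨g, hg, hginner⟩ := IsContMDiffRiemannianBundle.exists_contMDiff
    (IB := I) (n := n) (F := E) (E := fun x : M ↦ TangentSpace I x)
  have hgx : (g x).IsInvertible :=
    ⟨(InnerProductSpace.toDual ℝ (TangentSpace I x)).toContinuousLinearEquiv, by
      ext v w; exact hginner x v w⟩
  refine contMDiffAt_of_clm_bundle_apply hg.contMDiffAt hgx ?_
  convert hα using 3 with y
  ext v
  rw [← hginner, inner_sharp]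

theorem contMDiffAt_grad [IsManifold I 1 M]
    [IsContMDiffRiemannianBundle I m E (fun x : M ↦ TangentSpace I x)]
    {f : M → ℝ} (hf : ContMDiffAt I 𝓘(ℝ) n f x) (hmn : m + 1 ≤ n) :
    ContMDiffAt I I.tangent m (T% (grad f : Π y : M, TangentSpace I y)) x :=
  contMDiffAt_sharp (contMDiffAt_mvfderiv hf hmn)

end MusicalIsomorphism

section LeviCivita

variable {E : Type*} [NormedAddCommGroup E] [NormedSpace ℝ E] [FiniteDimensional ℝ E]
  {H : Type*} [TopologicalSpace H] {I : ModelWithCorners ℝ E H}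
  {M : Type*} [TopologicalSpace M] [ChartedSpace H M] [IsManifold I ∞ M]
  [RiemannianBundle (fun x : M ↦ TangentSpace I x)]
  [IsContMDiffRiemannianBundle I ∞ E (fun x : M ↦ TangentSpace I x)]
  {x : M} {X Y Z ξ : Π x : M, TangentSpace I x}

theorem leviCivita_sub_swap (hX : MDiffAt (T% X) x) (hY : MDiffAt (T% Y) x) :
    leviCivita Y x (X x) - leviCivita X x (Y x) = mlieBracket I X Y x :=
  have := FiniteDimensional.complete ℝ E
  (CovariantDerivative.torsion_eq_zero_iff _).1 leviCivita_torsion hX hY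

theorem leviCivita_smul_add_smul {φ ψ : M → ℝ} (hφ : MDiffAt φ x) (hY : MDiffAt (T% Y) x)
    (hψ : MDiffAt ψ x) (hZ : MDiffAt (T% Z) x) (v : TangentSpace I x) :
    leviCivita (fun y ↦ φ y • Y y + ψ y • Z y) x v =
      (φ x • leviCivita Y x v + d% φ x v • Y x) + (ψ x • leviCivita Z x v + d% ψ x v • Z x) := by
  have hconn := (leviCivita (I := I) (M := M)).isCovariantDerivativeOnUniv
  have hadd := hconn.add (hφ.smul_section hY) (hψ.smul_section hZ)
  rw [hconn.leibniz hY hφ, hconn.leibniz hZ hψ] at hadd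
  exact DFunLike.congr_fun hadd v

theorem hess_eq_inner_leviCivita_grad {f : M → ℝ}
    (hf : MDiffAt (T% (grad f : Π x : M, TangentSpace I x)) x)
    (hX : MDiffAt (T% X) x) (hY : MDiffAt (T% Y) x) :
    hess f X Y x = inner ℝ (leviCivita (grad f) x (X x)) (Y x) := by
  have hmetric := leviCivita_metric hX hf hY
  simp only [grad, inner_sharp] at hmetric
  rw [hess, hmetric]
  exact add_sub_cancel_right _ _

theorem mvfderiv_flat_sub_mvfderiv_flat_sub_flat_mlieBracket (hξ : MDiffAt (T% ξ) x)
    (hX : MDiffAt (T% X) x) (hY : MDiffAt (T% Y) x) :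
    d% (fun y ↦ flat ξ y (Y y)) x (X x) - d% (fun y ↦ flat ξ y (X y)) x (Y x)
        - flat ξ x (mlieBracket I X Y x) =
      inner ℝ (leviCivita ξ x (X x)) (Y x) - inner ℝ (leviCivita ξ x (Y x)) (X x) := by
  simp only [flat, innerSL_apply_apply]
  rw [leviCivita_metric hX hξ hY, leviCivita_metric hY hξ hX, ← leviCivita_sub_swap hX hY,
    inner_sub_right]
  ring

theorem ricci_eq_trace {A : TangentSpace I x →ₗ[ℝ] TangentSpace I x}
    (hA : ∀ v, curvature (extend E v) X Y x = A v) :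
    ricci X Y x = LinearMap.trace ℝ (TangentSpace I x) A := by
  rw [LinearMap.trace_eq_sum_inner A (stdOrthonormalBasis ℝ (TangentSpace I x)), ricci]
  simp only [hA, real_inner_comm]

/-- A torse-forming vector field in the sense of Yano: `∇_v ξ = φ v + θ(v) ξ` for a function `φ`
and a one-form `θ`. The condition `∇ξ = I - η ⊗ ξ` is the case `φ = 1`, `θ = -η`. -/
def IsTorseForming (φ : M → ℝ) (θ : Π x : M, TangentSpace I x →L[ℝ] ℝ)
    (ξ : Π x : M, TangentSpace I x) : Prop :=
  ∀ x, leviCivita ξ x = φ x • ContinuousLinearMap.id ℝ (TangentSpace I x) + (θ x).smulRight (ξ x)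

namespace IsTorseForming

variable {φ : M → ℝ} {θ : Π x : M, TangentSpace I x →L[ℝ] ℝ}

theorem leviCivita_apply (h : IsTorseForming φ θ ξ) (v : TangentSpace I x) :
    leviCivita ξ x v = φ x • v + θ x v • ξ x := by
  simp [h x]

theorem curvature_eq (h : IsTorseForming φ θ ξ) (hξ : MDiffAt (T% ξ) x) (hφ : MDiffAt φ x)
    (hX : MDiffAt (T% X) x) (hY : MDiffAt (T% Y) x)
    (hθX : MDiffAt (fun y ↦ θ y (X y)) x) (hθY : MDiffAt (fun y ↦ θ y (Y y)) x) :
    curvature X Y ξ x =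
      d% φ x (X x) • Y x - d% φ x (Y x) • X x
        + φ x • (θ x (Y x) • X x - θ x (X x) • Y x)
        + (d% (fun y ↦ θ y (Y y)) x (X x) - d% (fun y ↦ θ y (X y)) x (Y x)
          - θ x (mlieBracket I X Y x)) • ξ x := by
  simp only [curvature, h.leviCivita_apply]
  rw [leviCivita_smul_add_smul hφ hY hθY hξ, leviCivita_smul_add_smul hφ hX hθX hξ,
    h.leviCivita_apply, h.leviCivita_apply, ← leviCivita_sub_swap hX hY]
  module

variable {a b : ℝ}

theorem inner_leviCivita_apply (h : IsTorseForming φ (b • flat ξ) ξ) (v w : TangentSpace I x) :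
    inner ℝ (leviCivita ξ x v) w = φ x * inner ℝ v w + b * (flat ξ x v * flat ξ x w) := by
  simp only [h.leviCivita_apply, flat, Pi.smul_apply, smul_apply, coe_innerSL_apply, smul_eq_mul,
    inner_add_left, inner_smul_left, Real.ringHom_apply]
  ring

theorem curvature_eq_of_flat (h : IsTorseForming (fun _ ↦ a) (b • flat ξ) ξ)
    (hξ : MDiffAt (T% ξ) x) (hX : MDiffAt (T% X) x) (hY : MDiffAt (T% Y) x) :
    curvature X Y ξ x = (a * b) • (flat ξ x (Y x) • X x - flat ξ x (X x) • Y x) := by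
  have hηX : MDiffAt (fun y ↦ flat ξ y (X y)) x := mdiffAt_inner hξ hX
  have hηY : MDiffAt (fun y ↦ flat ξ y (Y y)) x := mdiffAt_inner hξ hY
  have hext := mvfderiv_flat_sub_mvfderiv_flat_sub_flat_mlieBracket hξ hX hY
  rw [h.inner_leviCivita_apply, h.inner_leviCivita_apply] at hext
  have hconst (Z : Π x : M, TangentSpace I x) (hηZ : MDiffAt (fun y ↦ flat ξ y (Z y)) x) :
      d% (fun y ↦ (b • flat ξ) y (Z y)) x = b • d% (fun y ↦ flat ξ y (Z y)) x := by
    change d% (fun y ↦ b * flat ξ y (Z y)) x = _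
    simp [mvfderiv_fun_mul mdifferentiableAt_const hηZ, mvfderiv_const]
  rw [h.curvature_eq hξ mdifferentiableAt_const hX hY (hηX.const_smul b) (hηY.const_smul b),
    hconst X hηX, hconst Y hηY]
  have hclosed : b * (d% (fun y ↦ flat ξ y (Y y)) x (X x) - d% (fun y ↦ flat ξ y (X y)) x (Y x)
      - flat ξ x (mlieBracket I X Y x)) = 0 := by
    rw [hext, real_inner_comm]
    ring
  simp only [mvfderiv_const, zero_apply, zero_smul, Pi.smul_apply, smul_apply, smul_eq_mul]
  linear_combination (norm := module) hclosed • ξ x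

theorem ricci_self_self (h : IsTorseForming (fun _ ↦ a) (b • flat ξ) ξ)
    (hξ : MDiffAt (T% ξ) x) :
    ricci ξ ξ x = a * b * (Module.finrank ℝ E - 1) * ‖ξ x‖ ^ 2 := by
  let A : TangentSpace I x →ₗ[ℝ] TangentSpace I x := (a * b) •
    (flat ξ x (ξ x) • LinearMap.id - (flat ξ x : TangentSpace I x →ₗ[ℝ] ℝ).smulRight (ξ x))
  have hA (v : TangentSpace I x) : curvature (extend E v) ξ ξ x = A v := by
    rw [h.curvature_eq_of_flat hξ (mdifferentiableAt_extend ..) hξ]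
    simp [A]
  have htrace : LinearMap.trace ℝ _ A =
      a * b * (flat ξ x (ξ x) * Module.finrank ℝ E - flat ξ x (ξ x)) := by
    have hdim : Module.finrank ℝ (TangentSpace I x) = Module.finrank ℝ E := rfl
    simp [A, hdim]
  have hnorm : flat ξ x (ξ x) = ‖ξ x‖ ^ 2 := by
    rw [flat, innerSL_apply_apply, real_inner_self_eq_norm_sq]
  rw [ricci_eq_trace hA, htrace, hnorm]
  ring

end IsTorseForming

end LeviCivita

end RiemGeom

end

open RiemGeom in
theorem mainTheorem7_general {E : Type*} [NormedAddCommGroup E] [NormedSpace ℝ E]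
    [FiniteDimensional ℝ E] {H : Type*} [TopologicalSpace H] {I : ModelWithCorners ℝ E H}
    {M : Type*} [TopologicalSpace M] [ChartedSpace H M] [IsManifold I ∞ M]
    [RiemannianBundle (fun x : M ↦ TangentSpace I x)]
    [IsContMDiffRiemannianBundle I ∞ E (fun x : M ↦ TangentSpace I x)]
    {a b : ℝ} {f : M → ℝ} (hf : ContMDiff I 𝓘(ℝ) 2 f)
    (h : IsTorseForming (fun _ ↦ a) (b • flat (grad f)) (grad f : Π x : M, TangentSpace I x))
    (x : M) :
    (∀ X Y : Π x : M, TangentSpace I x, MDiffAt (T% X) x → MDiffAt (T% Y) x →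
      hess f X Y x = a * inner ℝ (X x) (Y x) +
        b * (flat (grad f) x (X x) * flat (grad f) x (Y x))) ∧
    (∀ X Y : Π x : M, TangentSpace I x, MDiffAt (T% X) x → MDiffAt (T% Y) x →
      curvature X Y (grad f) x =
        (a * b) • (flat (grad f) x (Y x) • X x - flat (grad f) x (X x) • Y x)) ∧
    ricci (grad f) (grad f : Π x : M, TangentSpace I x) x =
      a * b * (Module.finrank ℝ E - 1) * ‖(grad f x : TangentSpace I x)‖ ^ 2 := by
  have hgrad : MDiffAt (T% (grad f : Π x : M, TangentSpace I x)) x :=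
    (contMDiffAt_grad (m := 1) (hf x) (by norm_num)).mdifferentiableAt one_ne_zero
  refine ⟨fun X Y hX hY ↦ ?_, fun X Y hX hY ↦ h.curvature_eq_of_flat hgrad hX hY,
    h.ricci_self_self hgrad⟩
  rw [hess_eq_inner_leviCivita_grad hgrad hX hY, h.inner_leviCivita_apply]

theorem mainTheorem7 {m : ℕ} {M : Type*} [TopologicalSpace M]
    [ChartedSpace (EuclideanSpace ℝ (Fin m)) M] [IsManifold (𝓡 m) ∞ M]
    [RiemannianBundle (fun x : M ↦ TangentSpace (𝓡 m) x)]
    [IsContMDiffRiemannianBundle (𝓡 m) ∞ (EuclideanSpace ℝ (Fin m))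
      (fun x : M ↦ TangentSpace (𝓡 m) x)]
    (f : M → ℝ) (hf : ContMDiff (𝓡 m) 𝓘(ℝ) ∞ f)
    (ξ : Π x : M, TangentSpace (𝓡 m) x) (hξ : ξ = RiemGeom.grad f)
    (η : Π x : M, TangentSpace (𝓡 m) x →L[ℝ] ℝ) (hη : η = RiemGeom.flat ξ)
    (h : ∀ x : M, RiemGeom.leviCivita ξ x =
      ContinuousLinearMap.id ℝ (TangentSpace (𝓡 m) x) - (η x).smulRight (ξ x)) :
    (∀ X Y : Π x : M, TangentSpace (𝓡 m) x,
      RiemGeom.IsSmoothField X → RiemGeom.IsSmoothField Y → ∀ x : M,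
      RiemGeom.hess f X Y x = inner ℝ (X x) (Y x) - η x (X x) * η x (Y x)) ∧
    (∀ X Y : Π x : M, TangentSpace (𝓡 m) x,
      RiemGeom.IsSmoothField X → RiemGeom.IsSmoothField Y → ∀ x : M,
      RiemGeom.curvature X Y ξ x = η x (X x) • Y x - η x (Y x) • X x) ∧
    (∀ x : M, RiemGeom.ricci ξ ξ x = (1 - (m : ℝ)) * ‖ξ x‖ ^ 2) := by
  subst hη hξ
  have htorse : RiemGeom.IsTorseForming (fun _ ↦ 1) ((-1 : ℝ) • RiemGeom.flat (RiemGeom.grad f))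
      (RiemGeom.grad f : Π x : M, TangentSpace (𝓡 m) x) := fun x ↦ by
    ext v
    simp [h x, sub_eq_add_neg]
  have hmain := mainTheorem7_general (hf.of_le ENat.LEInfty.out) htorse
  refine ⟨fun X Y hX hY x ↦ ?_, fun X Y hX hY x ↦ ?_, fun x ↦ ?_⟩
  · simpa [sub_eq_add_neg] using (hmain x).1 X Y (hX.mdiffAt x) (hY.mdiffAt x)
  · simpa using (hmain x).2.1 X Y (hX.mdiffAt x) (hY.mdiffAt x)
  · simpa using (hmain x).2.2
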